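/- Let $k$ be a commutative ring; all categories have $k$-modules as hom-sets with $k$-bilinear composition. For $k$-linear categories $A,B,C$ write $\operatorname{Rex}[A,C]$ for the category of $k$-linear functors $A\to C$ that are right exact (preserve finite colimits), with natural transformations as morphisms, and $\operatorname{Rex}[A,B;C]$ for the category of $k$-bilinear functors $A\times B\to C$ that are right exact in each variable, with natural transformations as morphisms. Let $A,B$ be small abelian $k$-linear categories. - A *tensor product of $A$ and $B$ as finitely cocomplete categories* is a locally small finitely cocomplete $k$-linear category $A\boxtimes B$ with a functor $\tau\in\operatorname{Rex}[A,B;A\boxtimes B]$ such that, for each locally small finitely cocomplete $k$-linear category $C$, composition with $\tau$ is an equivalence $\operatorname{Rex}[A\boxtimes B,C]\simeq\operatorname{Rex}[A,B;C]$. - A *Deligne tensor product of $A$ and $B$* is a locally small abelian $k$-linear category $A\bullet B$ with a functor $\chi\in\operatorname{Rex}[A,B;A\bullet B]$ such that, for each locally small abelian $k$-linear category $C$, composition with $\chi$ is an equivalence $\operatorname{Rex}[A\bullet B,C]\simeq\operatorname{Rex}[A,B;C]$. Theorem. A tensor product $A\boxtimes B$ as finitely cocomplete categories exists and is essentially small.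 For every such tensor product $(A\boxtimes B,\tau)$ the following are equivalent: 1. a Deligne tensor product $A\bullet B$ of $A$ and $B$ exists; 2. the category $A\boxtimes B$ is abelian. In that case the two tensor products coincide: $(A\boxtimes B,\tau)$ is a Deligne tensor product of $A$ and $B$, and for every Deligne tensor product $(A\bullet B,\chi)$ there is a $k$-linear equivalence $e:A\boxtimes B\to A\bullet B$ with $e\circ\tau\cong\chi$. -/

import Mathlib

open CategoryTheory CategoryTheory.Limits

universe w v u

namespace DeligneTensor

section Predicates

/-- The category `C`, with its given preadditive structure, is abelian. -/
def IsAbelianCategory (C : Type w) [Category.{v} C] [Preadditive C] : Prop :=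
  ∃ h : Abelian C, h.toPreadditive = ‹Preadditive C›

variable (k : Type u) [CommRing k]

/-- The property of a functor `A ⥤ C` of being a right exact `k`-linear functor:
additive, `k`-linear and preserving finite colimits. -/
def rex (A C : Type*) [Category* A] [Preadditive A] [Linear k A]
    [Category* C] [Preadditive C] [Linear k C] : ObjectProperty (A ⥤ C) :=
  fun F => F.Additive ∧ F.Linear k ∧ PreservesFiniteColimits F

/-- The property of a functor of two variables from `A`, `B` to `C` of being `k`-bilinear and
right exact in each variable: `b ↦ F (a, b)` is right exact `k`-linear for each `a`, and
`a ↦ F (a, b)` is right exact `k`-linear for each `b`. -/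
def rex₂ (A B C : Type*) [Category* A] [Preadditive A] [Linear k A]
    [Category* B] [Preadditive B] [Linear k B]
    [Category* C] [Preadditive C] [Linear k C] : ObjectProperty (A ⥤ B ⥤ C) :=
  fun F => (∀ a : A, rex k B C (F.obj a)) ∧ (∀ b : B, rex k A C (F.flip.obj b))

/-- `Rex[A, C]`: right exact `k`-linear functors `A ⥤ C` and natural transformations. -/
abbrev Rex (A C : Type*) [Category* A] [Preadditive A] [Linear k A]
    [Category* C] [Preadditive C] [Linear k C] :=
  (rex k A C).FullSubcategory

/-- `Rex[A, B; C]`: `k`-bilinear functors of two variables from `A`, `B` to `C` that are right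
exact in each variable, and natural transformations. -/
abbrev Rex₂ (A B C : Type*) [Category* A] [Preadditive A] [Linear k A]
    [Category* B] [Preadditive B] [Linear k B]
    [Category* C] [Preadditive C] [Linear k C] :=
  (rex₂ k A B C).FullSubcategory

end Predicates

section Comp

variable {k : Type u} [CommRing k]
  {A B D C : Type*} [Category* A] [Preadditive A] [Linear k A]
  [Category* B] [Preadditive B] [Linear k B]
  [Category* D] [Preadditive D] [Linear k D]
  [Category* C] [Preadditive C] [Linear k C]

theorem rex_comp {F : A ⥤ D} {G : D ⥤ C} (hF : rex k A D F) (hG : rex k D C G) :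
    rex k A C (F ⋙ G) := by
  obtain ⟨_, _, _⟩ := hF
  obtain ⟨_, _, _⟩ := hG
  exact ⟨inferInstance, inferInstance, comp_preservesFiniteColimits F G⟩

theorem rex₂_comp {χ : A ⥤ B ⥤ D} {G : D ⥤ C} (hχ : rex₂ k A B D χ) (hG : rex k D C G) :
    rex₂ k A B C (((Functor.postcompose₂).obj G).obj χ) :=
  ⟨fun a => rex_comp (hχ.1 a) hG, fun b => rex_comp (hχ.2 b) hG⟩

/-- Composition with `χ`, which sends a right exact `k`-linear functor `G : D ⥤ C` to
`(a, b) ↦ G (χ (a, b))`, as a functor `Rex[D, C] ⥤ Rex[A, B; C]`. -/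
def compWith {χ : A ⥤ B ⥤ D} (hχ : rex₂ k A B D χ) (C : Type*)
    [Category* C] [Preadditive C] [Linear k C] : Rex k D C ⥤ Rex₂ k A B C :=
  (rex₂ k A B C).lift
    ((rex k D C).ι ⋙ Functor.postcompose₂ ⋙ (evaluation _ _).obj χ)
    (fun G => rex₂_comp hχ G.property)

end Comp

section Tensor

variable (k : Type u) [CommRing k]
  {A : Type u} [Category.{u} A] [Preadditive A] [Linear k A]
  {B : Type u} [Category.{u} B] [Preadditive B] [Linear k B]

/-- `χ : A × B → T` exhibits `T` as the tensor product `A ⊠ B` of `A` and `B` as finitely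
cocomplete `k`-linear categories: `T` is finitely cocomplete, `χ` is `k`-bilinear and right exact
in each variable, and composition with `χ` is an equivalence `Rex[T, C] ≃ Rex[A, B; C]` for each
finitely cocomplete `k`-linear category `C`. -/
structure IsFinCocompleteTensor {T : Type w} [Category.{u} T] [Preadditive T] [Linear k T]
    (χ : A ⥤ B ⥤ T) : Prop where
  hasFiniteColimits : HasFiniteColimits T
  rex₂ : rex₂ k A B T χ
  universal : ∀ (C : Type (u + 1)) [Category.{u} C] [Preadditive C] [Linear k C]
    [HasFiniteColimits C], (compWith rex₂ C).IsEquivalence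

/-- `χ : A × B → D` exhibits `D` as Deligne's tensor product `A • B` of `A` and `B`:
`D` is abelian, `χ` is `k`-bilinear and right exact in each variable, and composition with `χ` is
an equivalence `Rex[D, C] ≃ Rex[A, B; C]` for each abelian `k`-linear category `C`. -/
structure IsDeligneTensor {D : Type w} [Category.{u} D] [Preadditive D] [Linear k D]
    (χ : A ⥤ B ⥤ D) : Prop where
  isAbelian : IsAbelianCategory D
  rex₂ : rex₂ k A B D χ
  universal : ∀ (C : Type (u + 1)) [Category.{u} C] [Abelian C] [Linear k C],
    (compWith rex₂ C).IsEquivalence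

variable (A B)

/-- Deligne's tensor product of `A` and `B` exists. -/
def DeligneTensorExists : Prop :=
  ∃ (D : Type (u + 1)) (_ : Category.{u} D) (_ : Preadditive D) (_ : Linear k D)
    (χ : A ⥤ B ⥤ D), IsDeligneTensor k χ

end Tensor

end DeligneTensor

/-! If `T` is abelian, its universal property restricts to abelian targets, so `T` is a Deligne
tensor product; any two of these are equivalent by the usual uniqueness argument. Two things remain:
that a Deligne product `D` forces `T` to be abelian, and that `T` exists.

Suppose `D` exists. Since `D` is finitely cocomplete, the bifunctor into it factors through a right
exact `F : T ⥤ D`, and precomposition with `F` is an equivalence of categories of right exact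
functors into every abelian category. For the target `(ModuleCat k)ᵒᵖ` this says that restriction
along `F` is an equivalence between left exact presheaves on `D` and on `T`. This alone makes `F` an
equivalence: extending the presheaf represented by `t` gives full faithfulness
(`faithful_of_precomp_isEquivalence`, `full_of_precomp_isEquivalence`), and comparing the presheaf
represented by `d` with a filtered colimit of those represented by the `F t` shows that `d` is a
retract of some `F t` (`essSurj_of_precomp_isEquivalence`). Hence `T` is abelian.

For existence, the presheaves of modules on `A × B` that are left exact in each variable are exactly
the objects orthogonal to a small set of maps between finitely presentable presheaves
(`isLocal_invertedBy_bilex_iff`), so they form a reflective subcategory. The closure of the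
reflected free presheaves under finite colimits is `A ⊠ B`. A bifunctor into `C` extends to it as a
partial left adjoint of the nerve functor on `C` (`rex_extension`), and `toNerve_bijective` shows
that every right exact functor arises so. -/

namespace DeligneTensor

/-! ### Uniqueness of universal bifunctors -/

section Uniqueness

variable {k : Type u} [CommRing k]
  {A B D C E : Type*} [Category* A] [Preadditive A] [Linear k A]
  [Category* B] [Preadditive B] [Linear k B]
  [Category* D] [Preadditive D] [Linear k D]
  [Category* E] [Preadditive E] [Linear k E]
  [Category* C] [Preadditive C] [Linear k C]

theorem rex_id : rex k A A (𝟭 A) := ⟨inferInstance, inferInstance, inferInstance⟩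

/-- A functor of two variables factors through a universal one. -/
theorem exists_factorization {χ : A ⥤ B ⥤ D} (hχ : rex₂ k A B D χ)
    (h : (compWith hχ C).IsEquivalence) {H : A ⥤ B ⥤ C} (hH : rex₂ k A B C H) :
    ∃ G : D ⥤ C, rex k D C G ∧ Nonempty (((Functor.postcompose₂).obj G).obj χ ≅ H) :=
  ⟨_, ((compWith hχ C).objPreimage ⟨H, hH⟩).property,
    ⟨(ObjectProperty.ι _).mapIso ((compWith hχ C).objObjPreimageIso ⟨H, hH⟩)⟩⟩

theorem nonempty_iso_of_comp_iso {χ : A ⥤ B ⥤ D} (hχ : rex₂ k A B D χ)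
    (h : (compWith hχ C).IsEquivalence) {G G' : D ⥤ C} (hG : rex k D C G) (hG' : rex k D C G')
    (e : ((Functor.postcompose₂).obj G).obj χ ≅ ((Functor.postcompose₂).obj G').obj χ) :
    Nonempty (G ≅ G') :=
  let e' : (compWith hχ C).obj ⟨G, hG⟩ ≅ (compWith hχ C).obj ⟨G', hG'⟩ :=
    (ObjectProperty.fullyFaithfulι _).preimageIso e
  ⟨(ObjectProperty.ι _).mapIso ((compWith hχ C).preimageIso e')⟩

/-- Two functors of two variables that are universal relative to each other's target are
equivalent. -/
theorem exists_equivalence_of_universal {χ : A ⥤ B ⥤ D} (hχ : rex₂ k A B D χ)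
    {ψ : A ⥤ B ⥤ E} (hψ : rex₂ k A B E ψ)
    (hDD : (compWith hχ D).IsEquivalence) (hDE : (compWith hχ E).IsEquivalence)
    (hED : (compWith hψ D).IsEquivalence) (hEE : (compWith hψ E).IsEquivalence) :
    ∃ e : D ≌ E, e.functor.Additive ∧ e.functor.Linear k ∧
      Nonempty (((Functor.postcompose₂).obj e.functor).obj χ ≅ ψ) := by
  obtain ⟨F, hF, ⟨i⟩⟩ := exists_factorization hχ hDE hψ
  obtain ⟨G, hG, ⟨j⟩⟩ := exists_factorization hψ hED hχ
  obtain ⟨η⟩ := nonempty_iso_of_comp_iso hχ hDD (rex_id (k := k)) (rex_comp hF hG)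
    (j.symm ≪≫ ((Functor.postcompose₂).obj G).mapIso i.symm)
  obtain ⟨ε⟩ := nonempty_iso_of_comp_iso hψ hEE (rex_comp hG hF) (rex_id (k := k))
    (((Functor.postcompose₂).obj F).mapIso j ≪≫ i)
  exact ⟨CategoryTheory.Equivalence.mk F G η ε, hF.1, hF.2.1, ⟨i⟩⟩

/-- Precomposition with a right exact `k`-linear functor. -/
def precomp {F : D ⥤ E} (hF : rex k D E F) (C : Type*) [Category* C] [Preadditive C]
    [Linear k C] : Rex k E C ⥤ Rex k D C :=
  (rex k D C).lift ((rex k E C).ι ⋙ (Functor.whiskeringLeft D E C).obj F)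
    (fun G => rex_comp hF G.property)

/-- A functor between the targets of two universal functors of two variables, compatible with
them, induces an equivalence on categories of right exact functors. -/
theorem precomp_isEquivalence {χ : A ⥤ B ⥤ D} (hχ : rex₂ k A B D χ)
    {ψ : A ⥤ B ⥤ E} (hψ : rex₂ k A B E ψ) {F : D ⥤ E} (hF : rex k D E F)
    (i : ((Functor.postcompose₂).obj F).obj χ ≅ ψ)
    (h : (compWith hχ C).IsEquivalence) (h' : (compWith hψ C).IsEquivalence) :
    (precomp hF C).IsEquivalence := by
  let e : precomp hF C ⋙ compWith hχ C ≅ compWith hψ C :=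
    NatIso.ofComponents
      (fun G => (ObjectProperty.fullyFaithfulι _).preimageIso
        (((Functor.postcompose₂).obj G.obj).mapIso i))
      (fun {G G'} f => by
        ext a b
        exact (f.hom.naturality ((i.hom.app a).app b)).symm)
  have : (precomp hF C ⋙ compWith hχ C).IsEquivalence := Functor.isEquivalence_of_iso e.symm
  exact Functor.isEquivalence_of_comp_right _ (compWith hχ C)

end Uniqueness

/-! ### Left exact presheaves and restriction along `F` -/

section Lex

variable (k : Type u) [CommRing k]

/-- The opposite of a `k`-linear category is `k`-linear. -/
instance linearOpposite (C : Type*) [Category* C] [Preadditive C] [Linear k C] : Linear k Cᵒᵖ where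
  homModule X Y := Equiv.module k (opEquiv X Y)
  smul_comp _ _ _ r f g := congrArg Quiver.Hom.op (Linear.comp_smul _ _ _ g.unop r f.unop)
  comp_smul _ _ _ f r g := congrArg Quiver.Hom.op (Linear.smul_comp _ _ _ r g.unop f.unop)

variable {D : Type*} [Category.{u} D] [Preadditive D] [Linear k D]

/-- The property of being a left exact `k`-linear functor `Dᵒᵖ ⥤ ModuleCat k`. -/
def lex (D : Type*) [Category.{u} D] [Preadditive D] [Linear k D] :
    ObjectProperty (Dᵒᵖ ⥤ ModuleCat.{u} k) :=
  fun P => P.Additive ∧ P.Linear k ∧ PreservesFiniteLimits P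

variable {k}

theorem rex_rightOp {P : Dᵒᵖ ⥤ ModuleCat.{u} k} (hP : lex k D P) :
    rex k D (ModuleCat.{u} k)ᵒᵖ P.rightOp := by
  obtain ⟨_, _, _⟩ := hP
  exact ⟨inferInstance, ⟨fun f r => congrArg Quiver.Hom.op (P.map_smul r f.op)⟩,
    preservesFiniteColimits_rightOp P⟩

theorem lex_leftOp {P : D ⥤ (ModuleCat.{u} k)ᵒᵖ} (hP : rex k D (ModuleCat.{u} k)ᵒᵖ P) :
    lex k D P.leftOp := by
  obtain ⟨_, _, _⟩ := hP
  exact ⟨⟨fun {_ _ f g} => congrArg Quiver.Hom.unop (P.map_add (f := f.unop) (g := g.unop))⟩,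
    ⟨fun f r => congrArg Quiver.Hom.unop (P.map_smul r f.unop)⟩,
    preservesFiniteLimits_leftOp P⟩

variable {T : Type*} [Category.{u} T] [Preadditive T] [Linear k T]
  {F : T ⥤ D} (hF : rex k T D F) (h : (precomp hF (ModuleCat.{u} k)ᵒᵖ).IsEquivalence)

include h

/-- Left exact presheaves are right exact functors into `(ModuleCat k)ᵒᵖ` with the arrows reversed,
so this and the next two lemmas unfold essential surjectivity, fullness and faithfulness of
`precomp`. -/
theorem exists_lex_extension {P : Tᵒᵖ ⥤ ModuleCat.{u} k} (hP : lex k T P) :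
    ∃ Q : Dᵒᵖ ⥤ ModuleCat.{u} k, lex k D Q ∧ Nonempty (F.op ⋙ Q ≅ P) := by
  let e := (ObjectProperty.ι _).mapIso
    ((precomp hF (ModuleCat.{u} k)ᵒᵖ).objObjPreimageIso ⟨P.rightOp, rex_rightOp hP⟩)
  exact ⟨_, lex_leftOp ((precomp hF (ModuleCat.{u} k)ᵒᵖ).objPreimage
    ⟨P.rightOp, rex_rightOp hP⟩).property, ⟨NatIso.ofComponents (fun t => (e.app t.unop).unop.symm)
      (fun {s t} f => congrArg Quiver.Hom.unop (e.inv.naturality f.unop).symm)⟩⟩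

theorem exists_lex_hom {P Q : Dᵒᵖ ⥤ ModuleCat.{u} k} (hP : lex k D P) (hQ : lex k D Q)
    (α : F.op ⋙ P ⟶ F.op ⋙ Q) : ∃ β : P ⟶ Q, Functor.whiskerLeft F.op β = α := by
  let α' : (precomp hF (ModuleCat.{u} k)ᵒᵖ).obj ⟨Q.rightOp, rex_rightOp hQ⟩ ⟶
      (precomp hF (ModuleCat.{u} k)ᵒᵖ).obj ⟨P.rightOp, rex_rightOp hP⟩ :=
    ObjectProperty.homMk (NatTrans.rightOp α)
  obtain ⟨β, hβ⟩ := (precomp hF (ModuleCat.{u} k)ᵒᵖ).map_surjective α'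
  refine ⟨NatTrans.leftOp β.hom, ?_⟩
  ext1
  ext1 t
  exact congrArg (fun γ => (NatTrans.app (InducedCategory.Hom.hom γ) t.unop).unop) hβ

theorem lex_hom_ext {P Q : Dᵒᵖ ⥤ ModuleCat.{u} k} (hP : lex k D P) (hQ : lex k D Q)
    {α β : P ⟶ Q} (hαβ : Functor.whiskerLeft F.op α = Functor.whiskerLeft F.op β) : α = β := by
  let lift (γ : P ⟶ Q) : (⟨Q.rightOp, rex_rightOp hQ⟩ : Rex k D (ModuleCat.{u} k)ᵒᵖ) ⟶
      ⟨P.rightOp, rex_rightOp hP⟩ := ObjectProperty.homMk (NatTrans.rightOp γ)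
  have : lift α = lift β := by
    apply (precomp hF (ModuleCat.{u} k)ᵒᵖ).map_injective
    ext t
    exact congrArg (fun γ => (NatTrans.app γ (Opposite.op t)).op) hαβ
  apply NatTrans.ext
  funext d
  exact congrArg (fun γ => (NatTrans.app (InducedCategory.Hom.hom γ) d.unop).unop) this

end Lex

section Yoneda

variable {k : Type u} [CommRing k] {D : Type*} [Category.{u} D] [Preadditive D] [Linear k D]

theorem lex_linearYoneda (d : D) : lex k D ((linearYoneda k D).obj d) := by
  refine ⟨inferInstance, ⟨fun f r => ?_⟩, ?_⟩
  · ext g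
    exact Linear.smul_comp _ _ _ r f.unop g
  · have : PreservesFiniteLimits ((linearYoneda k D).obj d ⋙ forget (ModuleCat.{u} k)) :=
      inferInstanceAs (PreservesFiniteLimits (yoneda.obj d))
    exact preservesFiniteLimits_of_reflects_of_preserves _ (forget (ModuleCat.{u} k))

/-- The action of a `k`-linear functor on morphisms, as a morphism of `k`-linear presheaves. -/
def mapLinearYoneda {T : Type*} [Category.{u} T] [Preadditive T] [Linear k T]
    (F : T ⥤ D) [F.Additive] [F.Linear k] (t : T) :
    (linearYoneda k T).obj t ⟶ F.op ⋙ (linearYoneda k D).obj (F.obj t) where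
  app s := ModuleCat.ofHom (F.mapLinearMap k)
  naturality s s' f := by
    ext g
    exact F.map_comp f.unop g

end Yoneda

/-! ### Full faithfulness of `F` -/

section Recognition

variable {k : Type u} [CommRing k]
  {D : Type*} [Category.{u} D] [Preadditive D] [Linear k D]
  {T : Type*} [Category.{u} T] [Preadditive T] [Linear k T]
  {F : T ⥤ D} (hF : rex k T D F) (h : (precomp hF (ModuleCat.{u} k)ᵒᵖ).IsEquivalence)

include h

/-- The presheaf represented by `t` extends along `F`, so its action on `f` depends only on `F.map
f`; applying it to the identity of `t` recovers `f`. -/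
theorem faithful_of_precomp_isEquivalence : F.Faithful where
  map_injective {s t} f g hfg := by
    obtain ⟨P, hP, ⟨θ⟩⟩ := exists_lex_extension hF h (lex_linearYoneda (k := k) t)
    have key (f : s ⟶ t) : θ.hom.app _ (P.map (F.map f).op (θ.inv.app _ (𝟙 t : t ⟶ t))) = f := by
      have h₁ := congr($(θ.hom.naturality f.op) (θ.inv.app _ (𝟙 t : t ⟶ t)))
      have h₂ := congr($(θ.inv_hom_id_app _) (𝟙 t : t ⟶ t))
      refine h₁.trans ((congrArg (((linearYoneda k T).obj t).map f.op) h₂).trans ?_)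
      exact Category.comp_id f
    rw [← key f, ← key g, hfg]

/-- Let `P` extend the presheaf represented by `t`, with `p` the element corresponding to the
identity. The action of `F` on morphisms extends to `γ` from `P` to the presheaf represented by `F
t`, and `γ` sends `p` to the identity. Naturality of `γ` at `g` then shows that the morphism
corresponding to `P.map g.op p` is a preimage of `g`. -/
theorem full_of_precomp_isEquivalence : F.Full where
  map_surjective {s t} g := by
    obtain ⟨P, hP, ⟨θ⟩⟩ := exists_lex_extension hF h (lex_linearYoneda (k := k) t)
    have := hF.1
    have := hF.2.1
    obtain ⟨γ, hγ⟩ := exists_lex_hom hF h hP (lex_linearYoneda (F.obj t))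
      (θ.hom ≫ mapLinearYoneda F t)
    let p := θ.inv.app _ (𝟙 t : t ⟶ t)
    have h₀ (x : T) (z : P.obj (Opposite.op (F.obj x))) :
        γ.app _ z = F.map (θ.hom.app (Opposite.op x) z) :=
      congr(NatTrans.app $hγ (Opposite.op x) z)
    have h₁ : γ.app _ p = 𝟙 (F.obj t) := by
      refine (h₀ t p).trans ?_
      have h₂ := congr($(θ.inv_hom_id_app _) (𝟙 t : t ⟶ t))
      exact (congrArg F.map h₂).trans (F.map_id t)
    refine ⟨θ.hom.app (Opposite.op s) (P.map g.op p), ?_⟩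
    rw [← h₀ s]
    refine (congr($(γ.naturality g.op) p)).trans ?_
    refine (congrArg (((linearYoneda k D).obj (F.obj t)).map g.op) h₁).trans ?_
    exact Category.comp_id g

end Recognition

/-! ### Filtered colimits of left exact presheaves -/

section FilteredColimit

variable {k : Type u} [CommRing k] {D : Type*} [Category.{u} D] [Preadditive D] [Linear k D]
  {J : Type u} [SmallCategory J] [IsFiltered J]

omit [Preadditive D] [Linear k D] in
theorem exists_rep_colimit (K : J ⥤ Dᵒᵖ ⥤ ModuleCat.{u} k) {X : Dᵒᵖ}
    (x : (colimit K).obj X) : ∃ (j : J) (y : (K.obj j).obj X), (colimit.ι K j).app X y = x :=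
  Types.jointly_surjective _ (isColimitOfPreserves ((evaluation _ _).obj X ⋙
    forget (ModuleCat.{u} k)) (colimit.isColimit K)) x

theorem lex_colimit (K : J ⥤ Dᵒᵖ ⥤ ModuleCat.{u} k) (hK : ∀ j, lex k D (K.obj j)) :
    lex k D (colimit K) := by
  have (j : J) := (hK j).1
  have (j : J) := (hK j).2.1
  have (j : J) := (hK j).2.2
  have nat (j : J) {X Y : Dᵒᵖ} (f : X ⟶ Y) (y) : (colimit K).map f ((colimit.ι K j).app X y) =
      (colimit.ι K j).app Y ((K.obj j).map f y) :=
    congr($((colimit.ι K j).naturality f) y).symm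
  refine ⟨⟨fun {X Y f g} => ?_⟩, ⟨fun {X Y} f r => ?_⟩, ?_⟩
  · ext x
    obtain ⟨j, y, rfl⟩ := exists_rep_colimit K x
    refine (nat j _ y).trans ?_
    rw [Functor.map_add]
    exact (map_add (ModuleCat.Hom.hom _) _ _).trans
      (congrArg₂ (· + ·) (nat j f y).symm (nat j g y).symm)
  · ext x
    obtain ⟨j, y, rfl⟩ := exists_rep_colimit K x
    refine (nat j _ y).trans ?_
    rw [Functor.map_smul]
    exact (map_smul (ModuleCat.Hom.hom _) _ _).trans (congrArg (r • ·) (nat j f y).symm)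
  · have : PreservesFiniteLimits K.flip :=
      ⟨fun J' _ _ => preservesLimitsOfShape_of_evaluation _ _
        (fun j => inferInstanceAs (PreservesLimitsOfShape J' (K.obj j)))⟩
    have : PreservesFiniteLimits (K.flip ⋙ colim) := comp_preservesFiniteLimits _ _
    exact preservesFiniteLimits_of_natIso (colimitIsoFlipCompColim K).symm

end FilteredColimit

/-! ### Essential surjectivity of `F` -/

section Recognition

variable {k : Type u} [CommRing k]
  {D : Type*} [Category.{u} D] [Preadditive D] [Linear k D]
  {T : Type*} [Category.{u} T] [Preadditive T] [Linear k T]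
  {F : T ⥤ D}

omit [Preadditive D] [Preadditive T] in
/-- An object that is a retract of an object in the image of a full functor preserving
coequalizers lies in the essential image. -/
theorem mem_essImage_of_retract [HasCoequalizers T] [F.Full] [PreservesFiniteColimits F]
    {d : D} {t : T} (i : d ⟶ F.obj t) (r : F.obj t ⟶ d) (hir : i ≫ r = 𝟙 d) :
    F.essImage d := by
  obtain ⟨e, he⟩ := F.map_surjective (r ≫ i)
  let hc := isColimitOfHasCoequalizerOfPreservesColimit F e (𝟙 t)
  have hπ : r ≫ i ≫ F.map (coequalizer.π e (𝟙 t)) = F.map (coequalizer.π e (𝟙 t)) := by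
    rw [← Category.assoc, ← he, ← F.map_comp, coequalizer.condition, Category.id_comp]
  have hr : F.map e ≫ r = F.map (𝟙 t) ≫ r := by simp [he, hir]
  have hd : F.map (coequalizer.π e (𝟙 t)) ≫ Cofork.IsColimit.desc hc r hr = r :=
    Cofork.IsColimit.π_desc' hc r hr
  refine ⟨coequalizer e (𝟙 t), ⟨⟨Cofork.IsColimit.desc hc r hr,
    i ≫ F.map (coequalizer.π e (𝟙 t)), ?_, ?_⟩⟩⟩
  · apply Cofork.IsColimit.hom_ext hc
    change F.map (coequalizer.π e (𝟙 t)) ≫ _ ≫ _ = F.map (coequalizer.π e (𝟙 t)) ≫ 𝟙 _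
    rw [reassoc_of% hd, hπ, Category.comp_id]
  · rw [Category.assoc, hd, hir]

variable (hF : rex k T D F) (h : (precomp hF (ModuleCat.{u} k)ᵒᵖ).IsEquivalence)

include h

/-- The comma category of `F` over `d` is filtered because `F` preserves finite colimits. The
colimit of the presheaves represented by its objects `F t` is left exact, and its map `φ` to the
presheaf represented by `d` becomes invertible on `T`. The inverse extends to a section of `φ`,
which factors the identity of `d` through some `F t`. -/
theorem essSurj_of_precomp_isEquivalence [HasFiniteColimits T] [EssentiallySmall.{u} T] :
    F.EssSurj where
  mem_essImage d := by
    have := full_of_precomp_isEquivalence hF h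
    obtain ⟨_, _, _⟩ := id hF
    have := coflat_of_preservesFiniteColimits F
    let e := equivSmallModel.{u} (CostructuredArrow F d)
    have : IsFiltered (SmallModel.{u} (CostructuredArrow F d)) := IsFiltered.of_equivalence e
    let K := e.inverse ⋙ CostructuredArrow.proj F d ⋙ F ⋙ linearYoneda k D
    let c : Cocone K :=
      { pt := (linearYoneda k D).obj d
        ι :=
          { app := fun j => (linearYoneda k D).map (e.inverse.obj j).hom
            naturality := fun i j f =>
              ((linearYoneda k D).map_comp _ _).symm.trans
                ((congrArg (linearYoneda k D).map (CostructuredArrow.w (e.inverse.map f))).trans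
                  (Category.comp_id _).symm) } }
    let φ : colimit K ⟶ (linearYoneda k D).obj d := colimit.desc K c
    have hφ (j) {X : D} (y : X ⟶ F.obj (e.inverse.obj j).left) :
        φ.app (Opposite.op X) ((colimit.ι K j).app (Opposite.op X) y) =
          y ≫ (e.inverse.obj j).hom :=
      ConcreteCategory.congr_hom (NatTrans.congr_app (colimit.ι_desc c j) (Opposite.op X)) y
    have hK : lex k D (colimit K) := lex_colimit K (fun j => lex_linearYoneda _)
    have : IsIso (Functor.whiskerLeft F.op φ) := by
      rw [NatTrans.isIso_iff_isIso_app]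
      intro t
      rw [ConcreteCategory.isIso_iff_bijective]
      constructor
      · refine (injective_iff_map_eq_zero (ModuleCat.Hom.hom (φ.app (F.op.obj t)))).2 fun x hx => ?_
        obtain ⟨j, y, rfl⟩ := exists_rep_colimit K x
        obtain ⟨g, rfl⟩ := F.map_surjective (X := t.unop) (Y := (e.inverse.obj j).left) y
        replace hx : F.map g ≫ (e.inverse.obj j).hom = 0 := (hφ j _).symm.trans hx
        -- The structure map to `d` kills `F.map g`, so it factors through the image of the cokernel
        -- of `g`. This gives an arrow in the comma category along which the element dies.
        let hc := isColimitOfHasCoequalizerOfPreservesColimit F g 0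
        let Y : CostructuredArrow F d := CostructuredArrow.mk
          (Cofork.IsColimit.desc hc (e.inverse.obj j).hom (by rw [hx, F.map_zero, zero_comp]))
        let a : e.inverse.obj j ⟶ Y := CostructuredArrow.homMk (coequalizer.π g 0)
          (Cofork.IsColimit.π_desc' hc _ _)
        -- The unit of `e` moves this arrow into the small model that indexes the colimit.
        obtain ⟨b, hb⟩ := e.inverse.map_surjective (a ≫ e.unit.app Y)
        have h₁ : F.map g ≫ F.map (e.inverse.map b).left = 0 := by
          rw [hb, ← F.map_comp]
          change F.map (g ≫ coequalizer.π g 0 ≫ _) = 0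
          rw [reassoc_of% coequalizer.condition g 0]
          simp
        have h₂ := congr(NatTrans.app $(colimit.w K b) (F.op.obj t) (F.map g))
        refine h₂.symm.trans ((congrArg ((colimit.ι K _).app (F.op.obj t)) h₁).trans ?_)
        exact map_zero (ModuleCat.Hom.hom _)
      · intro f
        let Y : CostructuredArrow F d := CostructuredArrow.mk (Y := t.unop) f
        refine ⟨(colimit.ι K (e.functor.obj Y)).app _ (F.map (e.unit.app Y).left), ?_⟩
        exact (hφ _ _).trans (CostructuredArrow.w (e.unit.app Y))
    obtain ⟨β, hβ⟩ := exists_lex_hom hF h (lex_linearYoneda d) hK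
      (inv (Functor.whiskerLeft F.op φ))
    have hβφ : β ≫ φ = 𝟙 _ := by
      apply lex_hom_ext hF h (lex_linearYoneda d) (lex_linearYoneda d)
      rw [Functor.whiskerLeft_comp, hβ, IsIso.inv_hom_id]
      rfl
    obtain ⟨j, y, hy⟩ := exists_rep_colimit K (β.app (Opposite.op d) (𝟙 d : d ⟶ d))
    refine mem_essImage_of_retract (t := (e.inverse.obj j).left) y (e.inverse.obj j).hom ?_
    rw [← hφ j y, hy]
    exact congr(NatTrans.app $hβφ (Opposite.op d) (𝟙 d : d ⟶ d))

end Recognition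

/-! ### Free presheaves and orthogonality to finitely presented maps -/

section FreePresheaf

variable (k : Type u) [CommRing k] (S : Type u) [Category.{u} S]

/-- The free presheaves of `k`-modules on representable presheaves. -/
noncomputable def free : S ⥤ Sᵒᵖ ⥤ ModuleCat.{u} k :=
  yoneda ⋙ (Functor.whiskeringRight _ _ _).obj (ModuleCat.free k)

variable {k S}

/-- Morphisms from a free presheaf are elements. -/
noncomputable def freeEquiv {s : S} {M : Sᵒᵖ ⥤ ModuleCat.{u} k} :
    ((free k S).obj s ⟶ M) ≃ M.obj (Opposite.op s) where
  toFun φ := φ.app (Opposite.op s) (ModuleCat.freeMk (𝟙 s : s ⟶ s))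
  invFun m :=
    { app := fun X => ModuleCat.freeDesc (↾fun f : X.unop ⟶ s => M.map f.op m)
      naturality := fun X Y g => by
        apply ModuleCat.free_hom_ext
        intro f
        change ModuleCat.freeDesc _ ((ModuleCat.free k).map _ (ModuleCat.freeMk f)) =
          M.map g (ModuleCat.freeDesc _ (ModuleCat.freeMk f))
        rw [ModuleCat.free_map_apply, ModuleCat.freeDesc_apply, ModuleCat.freeDesc_apply]
        change M.map (f.op ≫ g) m = _
        simp }
  left_inv φ := by
    ext X : 2
    apply ModuleCat.free_hom_ext
    intro f
    refine (ModuleCat.freeDesc_apply _ f).trans ?_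
    refine (congr($(φ.naturality f.op) (ModuleCat.freeMk (𝟙 s : s ⟶ s)))).symm.trans ?_
    change φ.app X ((ModuleCat.free k).map _ (ModuleCat.freeMk (𝟙 s : s ⟶ s))) = _
    rw [ModuleCat.free_map_apply]
    exact congrArg (fun g => φ.app X (ModuleCat.freeMk g)) (Category.comp_id f)
  right_inv m := (ModuleCat.freeDesc_apply _ _).trans congr($(M.map_id _) m)

theorem freeEquiv_comp {s : S} {M N : Sᵒᵖ ⥤ ModuleCat.{u} k} (φ : (free k S).obj s ⟶ M)
    (g : M ⟶ N) : freeEquiv (φ ≫ g) = g.app _ (freeEquiv φ) := rfl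

theorem freeEquiv_map_comp {s t : S} {M : Sᵒᵖ ⥤ ModuleCat.{u} k} (f : s ⟶ t)
    (φ : (free k S).obj t ⟶ M) :
    freeEquiv ((free k S).map f ≫ φ) = M.map f.op (freeEquiv φ) := by
  refine Eq.trans ?_ congr($(φ.naturality f.op) (ModuleCat.freeMk (𝟙 t : t ⟶ t)))
  change φ.app _ ((ModuleCat.free k).map _ (ModuleCat.freeMk (𝟙 s : s ⟶ s))) =
    φ.app _ ((ModuleCat.free k).map _ (ModuleCat.freeMk (𝟙 t : t ⟶ t)))
  rw [ModuleCat.free_map_apply, ModuleCat.free_map_apply]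
  exact congrArg (fun g => φ.app _ (ModuleCat.freeMk g))
    ((Category.id_comp f).trans (Category.comp_id f).symm)

theorem freeEquiv_add {s : S} {M : Sᵒᵖ ⥤ ModuleCat.{u} k} (φ ψ : (free k S).obj s ⟶ M) :
    freeEquiv (φ + ψ) = freeEquiv φ + freeEquiv ψ := rfl

theorem freeEquiv_sub {s : S} {M : Sᵒᵖ ⥤ ModuleCat.{u} k} (φ ψ : (free k S).obj s ⟶ M) :
    freeEquiv (φ - ψ) = freeEquiv φ - freeEquiv ψ := rfl

theorem freeEquiv_smul {s : S} {M : Sᵒᵖ ⥤ ModuleCat.{u} k} (r : k) (φ : (free k S).obj s ⟶ M) :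
    freeEquiv (r • φ) = r • freeEquiv φ := rfl

theorem freeEquiv_zero {s : S} {M : Sᵒᵖ ⥤ ModuleCat.{u} k} :
    freeEquiv (0 : (free k S).obj s ⟶ M) = 0 := rfl

attribute [local instance] Cardinal.fact_isRegular_aleph0

instance isCardinalPresentable_free (s : S) :
    IsCardinalPresentable ((free k S).obj s) Cardinal.aleph0.{u} where
  preservesColimitOfShape J _ _ := by
    have : IsFiltered J := isFiltered_of_isCardinalFiltered J Cardinal.aleph0.{u}
    let e : coyoneda.obj (Opposite.op ((free k S).obj s)) ≅
        (evaluation _ _).obj (Opposite.op s) ⋙ forget (ModuleCat.{u} k) :=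
      NatIso.ofComponents (fun M => freeEquiv.toIso) (fun g => rfl)
    exact preservesColimitsOfShape_of_natIso e.symm

variable (k S) in
/-- Indices for the free presheaves on one generator and for the presheaves with one generator
and one relation. -/
abbrev PresentationIndex := S ⊕ Σ (p : S × S), (free k S).obj p.1 ⟶ (free k S).obj p.2

/-- The presheaf with a given presentation. -/
noncomputable def presented : PresentationIndex k S → (Sᵒᵖ ⥤ ModuleCat.{u} k)
  | .inl s => (free k S).obj s
  | .inr δ => cokernel δ.2

instance isCardinalPresentable_presented (i : PresentationIndex k S) :
    IsCardinalPresentable (presented i) Cardinal.aleph0.{u} := by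
  obtain s | ⟨⟨s, t⟩, δ⟩ := i
  · exact isCardinalPresentable_free s
  · have := isClosedUnderColimitsOfShape_isCardinalPresentable (Sᵒᵖ ⥤ ModuleCat.{u} k)
      (κ := Cardinal.aleph0.{u}) (J := WalkingParallelPair)
      (by rw [hasCardinalLT_aleph0_iff]; infer_instance)
    refine (isCardinalPresentable _ Cardinal.aleph0.{u}).prop_of_isColimit
      (colimit.isColimit (parallelPair δ 0)) ?_
    rintro (_ | _)
    · exact isCardinalPresentable_free s
    · exact isCardinalPresentable_free t

/-- The morphisms between presheaves with at most one relation which are seen as isomorphisms by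
all presheaves satisfying `Q`. -/
abbrev InvertedBy (Q : ObjectProperty (Sᵒᵖ ⥤ ModuleCat.{u} k)) :=
  { i : Σ (i j : PresentationIndex k S), presented i ⟶ presented j //
    ∀ M, Q M → Function.Bijective (fun g : presented i.2.1 ⟶ M => i.2.2 ≫ g) }

/-- The class of morphisms between presheaves with at most one relation which are seen as
isomorphisms by all presheaves satisfying `Q`. -/
def invertedBy (Q : ObjectProperty (Sᵒᵖ ⥤ ModuleCat.{u} k)) :
    MorphismProperty (Sᵒᵖ ⥤ ModuleCat.{u} k) :=
  MorphismProperty.ofHoms (fun i : InvertedBy Q => i.1.2.2)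

theorem mem_invertedBy {Q : ObjectProperty (Sᵒᵖ ⥤ ModuleCat.{u} k)} (i j : PresentationIndex k S)
    (f : presented i ⟶ presented j)
    (hf : ∀ N, Q N → Function.Bijective (fun g : presented j ⟶ N => f ≫ g)) :
    invertedBy Q f :=
  MorphismProperty.ofHoms.mk (f := fun i : InvertedBy Q => i.1.2.2) ⟨⟨i, j, f⟩, hf⟩

instance (Q : ObjectProperty (Sᵒᵖ ⥤ ModuleCat.{u} k)) :
    MorphismProperty.IsSmall.{u} (invertedBy Q) :=
  MorphismProperty.isSmall_ofHoms _

theorem le_isLocal_invertedBy (Q : ObjectProperty (Sᵒᵖ ⥤ ModuleCat.{u} k)) :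
    Q ≤ (invertedBy Q).isLocal := by
  rintro M hM _ _ _ ⟨i⟩
  exact i.2 M hM

/-- Restricting to maps between presented presheaves keeps the class small with finitely presentable
sources and targets, as the orthogonal reflection theorem requires. -/
instance isRightAdjoint_ι_isLocal_invertedBy (Q : ObjectProperty (Sᵒᵖ ⥤ ModuleCat.{u} k)) :
    (invertedBy Q).isLocal.ι.IsRightAdjoint := by
  apply MorphismProperty.isRightAdjoint_ι_isLocal _ Cardinal.aleph0.{u}
  rintro _ _ _ ⟨i⟩
  exact ⟨inferInstance, inferInstance⟩

variable {Q : ObjectProperty (Sᵒᵖ ⥤ ModuleCat.{u} k)} {M : Sᵒᵖ ⥤ ModuleCat.{u} k}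
  (hM : (invertedBy Q).isLocal M)

include hM

/-- Killing `δ` is the same as being orthogonal to the projection onto its cokernel, so an equation
valid throughout `Q` passes to local presheaves. -/
theorem comp_eq_zero_of_isLocal {s t : S} (δ : (free k S).obj s ⟶ (free k S).obj t)
    (hδ : ∀ N, Q N → ∀ g : _ ⟶ N, δ ≫ g = 0) (g : (free k S).obj t ⟶ M) : δ ≫ g = 0 := by
  have key (N) (hN : Q N) : Function.Bijective (fun g : cokernel δ ⟶ N => cokernel.π δ ≫ g) :=
    ⟨fun g₁ g₂ h => (cancel_epi (cokernel.π δ)).1 h,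
      fun g => ⟨cokernel.desc δ g (hδ N hN g), cokernel.π_desc _ _ _⟩⟩
  obtain ⟨g', rfl⟩ := (hM (cokernel.π δ)
    (mem_invertedBy (.inl t) (.inr ⟨(s, t), δ⟩) (cokernel.π δ) key)).2 g
  exact (cokernel.condition_assoc δ g').trans zero_comp

/-- Here the condition is orthogonality to the map from the cokernel of `δ` induced by `π`. It
carries exactness conditions from `Q` to local presheaves. -/
theorem exists_unique_of_isLocal {s t v : S} (δ : (free k S).obj s ⟶ (free k S).obj t)
    (π : (free k S).obj t ⟶ (free k S).obj v) (w : δ ≫ π = 0)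
    (hπ : ∀ N, Q N → ∀ g : (free k S).obj t ⟶ N, δ ≫ g = 0 → ∃! g', π ≫ g' = g)
    (g : (free k S).obj t ⟶ M) (hg : δ ≫ g = 0) : ∃! g', π ≫ g' = g := by
  have key (N) (hN : Q N) :
      Function.Bijective (fun g : (free k S).obj v ⟶ N => cokernel.desc δ π w ≫ g) := by
    refine ⟨fun g₁ g₂ h => ?_, fun g => ?_⟩
    · refine (hπ N hN (π ≫ g₁) (by rw [reassoc_of% w, zero_comp])).unique rfl ?_
      have := congr(cokernel.π δ ≫ $h)
      simpa using this.symm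
    · obtain ⟨g', hg', -⟩ := hπ N hN (cokernel.π δ ≫ g) (by simp)
      exact ⟨g', (cancel_epi (cokernel.π δ)).1 (by simpa using hg')⟩
  have h := hM (cokernel.desc δ π w)
    (mem_invertedBy (.inr ⟨(s, t), δ⟩) (.inl v) (cokernel.desc δ π w) key)
  obtain ⟨g', hg'⟩ := h.2 (cokernel.desc δ g hg)
  dsimp only at hg'
  refine ⟨g', ?_, fun g'' hg'' => h.1 ((cancel_epi (cokernel.π δ)).1 ?_)⟩
  · simpa using congr(cokernel.π δ ≫ $hg')
  · simpa [hg'] using hg''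

end FreePresheaf

/-! ### Left exactness as unique lifting along cokernels -/

section LexCriterion

variable {k : Type u} [CommRing k] {X : Type*} [Category.{u} X] [Abelian X] [Linear k X]
  {P : Xᵒᵖ ⥤ ModuleCat.{u} k}

theorem existsUnique_of_lex (hP : lex k X P) {x y : X} (f : x ⟶ y) (m : P.obj (Opposite.op y))
    (hm : P.map f.op m = 0) : ∃! m', P.map (cokernel.π f).op m' = m := by
  obtain ⟨_, _, _⟩ := hP
  have hl := isLimitForkMapOfIsLimit' P _ (CokernelCofork.IsColimit.ofπOp _ (cokernel.condition f)
    (cokernelIsCokernel f))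
  let S : ShortComplex (ModuleCat.{u} k) := ShortComplex.mk (P.map (cokernel.π f).op) (P.map f.op)
    (by rw [← P.map_comp, ← op_comp, cokernel.condition, op_zero, P.map_zero])
  have hS : S.Exact := S.exact_of_f_is_kernel hl
  have : Mono S.f := mono_of_isLimit_fork hl
  obtain ⟨m', hm'⟩ := S.moduleCat_exact_iff.1 hS m hm
  exact ⟨m', hm', fun m'' h => (ModuleCat.mono_iff_injective S.f).1 this (h.trans hm'.symm)⟩

theorem lex_of_existsUnique (hadd : P.Additive) (hlin : P.Linear k)
    (h : ∀ {x y : X} (f : x ⟶ y) (m : P.obj (Opposite.op y)), P.map f.op m = 0 →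
      ∃! m', P.map (cokernel.π f).op m' = m) : lex k X P := by
  have (Y Z : Xᵒᵖ) (f : Y ⟶ Z) : PreservesLimit (parallelPair f 0) P := by
    refine preservesLimit_of_preserves_limit_cone
      (CokernelCofork.IsColimit.ofπOp _ (cokernel.condition f.unop) (cokernelIsCokernel f.unop)) ?_
    refine (isLimitMapConeForkEquiv' P _).symm ?_
    let S : ShortComplex (ModuleCat.{u} k) :=
      ShortComplex.mk (P.map (cokernel.π f.unop).op) (P.map f)
      (by rw [← P.map_comp, show (cokernel.π f.unop).op ≫ f = 0 from
        Quiver.Hom.unop_inj (cokernel.condition f.unop), P.map_zero])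
    have hS : S.Exact := S.moduleCat_exact_iff.2 fun m hm => (h f.unop m hm).exists
    have : Mono S.f := (ModuleCat.mono_iff_injective S.f).2 <|
      (injective_iff_map_eq_zero (ModuleCat.Hom.hom S.f)).2 fun a ha =>
        (h f.unop 0 (map_zero (ModuleCat.Hom.hom (P.map f)))).unique ha
          (map_zero (ModuleCat.Hom.hom S.f))
    exact hS.fIsKernel
  exact ⟨hadd, hlin, Functor.preservesFiniteLimits_of_preservesKernels P⟩

end LexCriterion

/-! ### Local presheaves inherit left exactness in one variable -/

section Slots

variable {k : Type u} [CommRing k] {S : Type u} [Category.{u} S]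
  {X : Type*} [Category.{u} X] [Abelian X] [Linear k X] {j : X ⥤ S}
  {Q : ObjectProperty (Sᵒᵖ ⥤ ModuleCat.{u} k)} {M : Sᵒᵖ ⥤ ModuleCat.{u} k}

/-- Additivity and linearity are equations between maps of free presheaves, and preservation of
kernels is a unique factorization; each is an orthogonality condition satisfied by `Q`. -/
theorem lex_of_isLocal (hQ : ∀ N, Q N → lex k X (j.op ⋙ N)) (hM : (invertedBy Q).isLocal M) :
    lex k X (j.op ⋙ M) := by
  have hadd : (j.op ⋙ M).Additive := by
    refine ⟨fun {x y f g} => ?_⟩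
    ext m
    obtain ⟨φ, rfl⟩ := freeEquiv.surjective m
    have := comp_eq_zero_of_isLocal hM ((free k S).map (j.map (f + g).unop) -
      (free k S).map (j.map f.unop) - (free k S).map (j.map g.unop)) (fun N hN ψ => by
        have := (hQ N hN).1
        apply freeEquiv.injective
        simp only [Preadditive.sub_comp, freeEquiv_sub, freeEquiv_map_comp, freeEquiv_zero]
        rw [sub_sub, sub_eq_zero]
        exact congr($((j.op ⋙ N).map_add (f := f) (g := g)) (freeEquiv ψ))) φ
    apply_fun freeEquiv at this
    simp only [Preadditive.sub_comp, freeEquiv_sub, freeEquiv_map_comp, freeEquiv_zero] at this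
    rw [sub_sub, sub_eq_zero] at this
    exact this
  have hlin : (j.op ⋙ M).Linear k := by
    refine ⟨fun {x y} f r => ?_⟩
    ext m
    obtain ⟨φ, rfl⟩ := freeEquiv.surjective m
    have := comp_eq_zero_of_isLocal hM ((free k S).map (j.map (r • f).unop) -
      r • (free k S).map (j.map f.unop)) (fun N hN ψ => by
        have := (hQ N hN).2.1
        apply freeEquiv.injective
        simp only [Preadditive.sub_comp, Linear.smul_comp, freeEquiv_sub, freeEquiv_smul,
          freeEquiv_map_comp, freeEquiv_zero]
        rw [sub_eq_zero]
        exact congr($((j.op ⋙ N).map_smul r f) (freeEquiv ψ))) φ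
    apply_fun freeEquiv at this
    simp only [Preadditive.sub_comp, Linear.smul_comp, freeEquiv_sub, freeEquiv_smul,
      freeEquiv_map_comp, freeEquiv_zero] at this
    rw [sub_eq_zero] at this
    exact this
  refine lex_of_existsUnique hadd hlin fun {x y} f m hm => ?_
  -- The free presheaves ignore the linear structure of `X`, so the generator attached to a zero
  -- morphism is not zero. Subtracting it makes the composite with the cokernel map vanish, and
  -- additive presheaves do not see the correction.
  have hδ (N : Sᵒᵖ ⥤ ModuleCat.{u} k) (hN : (j.op ⋙ N).Additive)
      (g : (free k S).obj (j.obj y) ⟶ N) :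
      ((free k S).map (j.map f) - (free k S).map (j.map 0)) ≫ g = 0 ↔
        (j.op ⋙ N).map f.op (freeEquiv g) = 0 := by
    rw [← freeEquiv.injective.eq_iff, Preadditive.sub_comp, freeEquiv_sub, freeEquiv_map_comp,
      freeEquiv_map_comp, freeEquiv_zero]
    have h₀ : N.map (j.map (0 : x ⟶ y)).op (freeEquiv g) = 0 :=
      congr($((j.op ⋙ N).map_zero (Opposite.op y) (Opposite.op x)) (freeEquiv g))
    rw [h₀, sub_zero]
    rfl
  have hπ (N : Sᵒᵖ ⥤ ModuleCat.{u} k) (g : (free k S).obj (j.obj y) ⟶ N) :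
      (∃! g', (free k S).map (j.map (cokernel.π f)) ≫ g' = g) ↔
        ∃! m', (j.op ⋙ N).map (cokernel.π f).op m' = freeEquiv g := by
    refine Iff.trans (existsUnique_congr fun g' => ?_) freeEquiv.bijective.existsUnique_iff.symm
    rw [← freeEquiv.injective.eq_iff, freeEquiv_map_comp]
    rfl
  obtain ⟨φ, rfl⟩ := freeEquiv.surjective m
  refine (hπ M φ).1 (exists_unique_of_isLocal hM
    ((free k S).map (j.map f) - (free k S).map (j.map 0)) _ ?_ (fun N hN g hg => ?_) φ
      ((hδ M hadd φ).2 hm))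
  · rw [Preadditive.sub_comp, sub_eq_zero]
    simp only [← Functor.map_comp, cokernel.condition, zero_comp]
  · exact (hπ N g).2 (existsUnique_of_lex (hQ N hN) f _ ((hδ N (hQ N hN).1 g).1 hg))

end Slots

/-! ### Right exactness tested on representable presheaves -/

section RexCriterion

variable {k : Type u} [CommRing k] {X T : Type*} [Category.{u} X] [Preadditive X] [Linear k X]
  [Category.{u} T] [Preadditive T] [Linear k T] {K : X ⥤ T}

theorem lex_op_comp_linearYoneda (hK : rex k X T K) (t : T) :
    lex k X (K.op ⋙ (linearYoneda k T).obj t) := by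
  obtain ⟨_, _, _⟩ := hK
  obtain ⟨_, _, _⟩ := lex_linearYoneda (k := k) t
  have := preservesFiniteLimits_op K
  refine ⟨inferInstance, ⟨fun f r => ?_⟩, comp_preservesFiniteLimits _ _⟩
  ext g
  exact (congrArg (fun h => h ≫ g) (K.map_smul r f.unop)).trans (Linear.smul_comp _ _ _ _ _ _)

theorem rex_of_lex_op_comp_linearYoneda
    (h : ∀ t : T, lex k X (K.op ⋙ (linearYoneda k T).obj t)) : rex k X T K := by
  refine ⟨⟨fun {x y f g} => ?_⟩, ⟨fun {x y} f r => ?_⟩, ⟨fun J _ _ => ⟨fun {D} => ⟨fun {c} hc =>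
    ⟨(Cocone.isColimitYonedaEquiv _).symm fun t => ?_⟩⟩⟩⟩⟩
  · have := (h (K.obj y)).1
    have h₁ : K.map (f + g) ≫ 𝟙 (K.obj y) = K.map f ≫ 𝟙 _ + K.map g ≫ 𝟙 _ :=
      congr($((K.op ⋙ (linearYoneda k T).obj (K.obj y)).map_add (f := f.op) (g := g.op))
        (𝟙 (K.obj y)))
    simpa using h₁
  · have := (h (K.obj y)).2.1
    have h₁ : K.map (r • f) ≫ 𝟙 (K.obj y) = r • (K.map f ≫ 𝟙 _) :=
      congr($((K.op ⋙ (linearYoneda k T).obj (K.obj y)).map_smul r f.op) (𝟙 (K.obj y)))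
    simpa using h₁
  · have := (h t).2.2
    have : PreservesFiniteLimits ((K.op ⋙ (linearYoneda k T).obj t) ⋙ forget _) :=
      comp_preservesFiniteLimits _ _
    exact isLimitOfPreserves ((K.op ⋙ (linearYoneda k T).obj t) ⋙ forget _) hc.op

end RexCriterion

/-! ### The closure of the generators under finite colimits -/

section Closure

variable {k : Type u} [CommRing k] {S : Type u} [Category.{u} S]
  (Q : ObjectProperty (Sᵒᵖ ⥤ ModuleCat.{u} k))

/-- The reflective subcategory of presheaves generated by the presheaves satisfying `Q`. -/
abbrev LocalPresheaf := (invertedBy Q).isLocal.FullSubcategory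

noncomputable instance : Reflective (invertedBy Q).isLocal.ι where
  L := (invertedBy Q).isLocal.ι.leftAdjoint
  adj := Adjunction.ofIsRightAdjoint _

instance : HasColimitsOfSize.{u, u} (LocalPresheaf Q) :=
  hasColimits_of_reflective (invertedBy Q).isLocal.ι

/-- The reflections of the free presheaves. -/
noncomputable def localFree : S ⥤ LocalPresheaf Q :=
  free k S ⋙ (invertedBy Q).isLocal.ι.leftAdjoint

/-- The unit of the reflection on a free presheaf. -/
noncomputable def toLocalFree (s : S) : (free k S).obj s ⟶ ((localFree Q).obj s).obj :=
  (Adjunction.ofIsRightAdjoint (invertedBy Q).isLocal.ι).unit.app ((free k S).obj s)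

/-- The closure under finite colimits of the reflections of the free presheaves. -/
def finPresented : ObjectProperty (LocalPresheaf Q) :=
  (ObjectProperty.ofObj (localFree Q).obj).colimitsCardinalClosure Cardinal.aleph0.{u}

/-- The category of finite colimits of reflections of free presheaves. -/
abbrev FinPresented := (finPresented Q).FullSubcategory

instance (J : Type v) [SmallCategory J] [FinCategory J] :
    (finPresented Q).IsClosedUnderColimitsOfShape J :=
  ObjectProperty.isClosedUnderColimitsOfShape_colimitsCardinalClosure _ _ J
    (by rw [hasCardinalLT_aleph0_iff]; infer_instance)

instance : (finPresented Q).IsClosedUnderIsomorphisms :=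
  inferInstanceAs (ObjectProperty.colimitsCardinalClosure _ _).IsClosedUnderIsomorphisms

instance : HasFiniteColimits (LocalPresheaf Q) :=
  hasFiniteColimits_of_hasColimitsOfSize _

instance : HasFiniteColimits (FinPresented Q) where
  out _ _ _ := inferInstance

instance : PreservesFiniteColimits (finPresented Q).ι where
  preservesFiniteColimits _ _ _ := inferInstance

instance : EssentiallySmall.{u} (FinPresented Q) := by
  have : ObjectProperty.EssentiallySmall.{u} (finPresented Q) := by
    dsimp only [finPresented]; infer_instance
  infer_instance

theorem rex_ι_finPresented : rex k _ _ (finPresented Q).ι :=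
  ⟨inferInstance, inferInstance, inferInstance⟩

/-- The generators of `FinPresented Q`. -/
noncomputable def generator : S ⥤ FinPresented Q :=
  (finPresented Q).lift (localFree Q)
    (fun s => ObjectProperty.le_colimitsCardinalClosure _ _ _ (ObjectProperty.ofObj_apply _ s))

variable {Q}

/-- A finite category in the sense of cardinals. -/
theorem nonempty_finCategory_of_hasCardinalLT {J : Type v} [SmallCategory J]
    (hJ : HasCardinalLT (Arrow J) Cardinal.aleph0.{u}) : Nonempty (FinCategory J) := by
  rw [hasCardinalLT_aleph0_iff] at hJ
  have : Finite J := Finite.of_injective (fun j => Arrow.mk (𝟙 j))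
    (fun i j h => congrArg Comma.left h)
  have (i j : J) : Finite (i ⟶ j) := Finite.of_injective _ (Arrow.mk_injective i j)
  exact ⟨{ fintypeObj := Fintype.ofFinite _, fintypeHom := fun _ _ => Fintype.ofFinite _ }⟩

theorem finPresented_le {P : ObjectProperty (LocalPresheaf Q)} [P.IsClosedUnderIsomorphisms]
    (h₁ : ∀ s, P ((localFree Q).obj s))
    (h₂ : ∀ (J : Type u) [SmallCategory J] [FinCategory J], P.IsClosedUnderColimitsOfShape J) :
    finPresented Q ≤ P := by
  refine ObjectProperty.colimitsCardinalClosure_le _ _ (fun J _ hJ => ?_) ?_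
  · obtain ⟨_⟩ := nonempty_finCategory_of_hasCardinalLT hJ
    exact h₂ J
  · rintro _ ⟨s⟩
    exact h₁ s

/-- Morphisms from the reflection of a free presheaf are elements. -/
noncomputable def localFreeEquiv {s : S} {M : LocalPresheaf Q} :
    ((localFree Q).obj s ⟶ M) ≃ M.obj.obj (Opposite.op s) :=
  ((Adjunction.ofIsRightAdjoint (invertedBy Q).isLocal.ι).homEquiv _ _).trans freeEquiv

theorem localFreeEquiv_apply {s : S} {M : LocalPresheaf Q} (φ : (localFree Q).obj s ⟶ M) :
    localFreeEquiv φ = freeEquiv (toLocalFree Q s ≫ φ.hom) :=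
  congrArg freeEquiv (Adjunction.homEquiv_unit _ _ _ _)

theorem localFreeEquiv_comp {s : S} {M N : LocalPresheaf Q} (φ : (localFree Q).obj s ⟶ M)
    (g : M ⟶ N) : localFreeEquiv (φ ≫ g) = g.hom.app _ (localFreeEquiv φ) := by
  rw [localFreeEquiv_apply, localFreeEquiv_apply, ← freeEquiv_comp, Category.assoc,
    InducedCategory.comp_hom]

theorem localFreeEquiv_map_comp {s t : S} {M : LocalPresheaf Q} (f : s ⟶ t)
    (φ : (localFree Q).obj t ⟶ M) :
    localFreeEquiv ((localFree Q).map f ≫ φ) = M.obj.map f.op (localFreeEquiv φ) := by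
  rw [localFreeEquiv_apply, localFreeEquiv_apply, ← freeEquiv_map_comp]
  exact congrArg freeEquiv ((Adjunction.ofIsRightAdjoint
    (invertedBy Q).isLocal.ι).unit_naturality_assoc ((free k S).map f) φ.hom)

theorem localFreeEquiv_add {s : S} {M : LocalPresheaf Q} (φ ψ : (localFree Q).obj s ⟶ M) :
    localFreeEquiv (φ + ψ) = localFreeEquiv φ + localFreeEquiv ψ := by
  rw [localFreeEquiv_apply, localFreeEquiv_apply, localFreeEquiv_apply, ← freeEquiv_add,
    ← Preadditive.comp_add]
  rfl

theorem localFreeEquiv_smul {s : S} {M : LocalPresheaf Q} (r : k) (φ : (localFree Q).obj s ⟶ M) :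
    localFreeEquiv (r • φ) = r • localFreeEquiv φ := by
  rw [localFreeEquiv_apply, localFreeEquiv_apply, ← freeEquiv_smul, ← Linear.comp_smul]
  rfl

theorem localPresheaf_hom_ext {M N : LocalPresheaf Q} {f g : M ⟶ N}
    (h : ∀ (s : S) (x : (localFree Q).obj s ⟶ M), localFreeEquiv (x ≫ f) = localFreeEquiv (x ≫ g)) :
    f = g := by
  ext s m
  obtain ⟨x, rfl⟩ := localFreeEquiv.surjective m
  simpa only [localFreeEquiv_comp] using h s.unop x

/-- The presheaf on the generators represented by an object of `FinPresented Q`. -/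
noncomputable def generatorIso (t : FinPresented Q) :
    (generator Q).op ⋙ (linearYoneda k _).obj t ≅ t.obj.obj :=
  NatIso.ofComponents (fun s => LinearEquiv.toModuleIso
    { toFun := fun x => localFreeEquiv x.hom
      invFun := fun m => ObjectProperty.homMk (localFreeEquiv.symm m)
      left_inv := fun x => by ext1; exact localFreeEquiv.symm_apply_apply x.hom
      right_inv := fun m => localFreeEquiv.apply_symm_apply m
      map_add' := fun x y => localFreeEquiv_add x.hom y.hom
      map_smul' := fun r x => localFreeEquiv_smul r x.hom })
    (fun {s s'} f => by
      ext x
      exact localFreeEquiv_map_comp f.unop x.hom)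

theorem isLocal_generator_comp_linearYoneda (t : FinPresented Q) :
    (invertedBy Q).isLocal ((generator Q).op ⋙ (linearYoneda k _).obj t) :=
  (invertedBy Q).isLocal.prop_of_iso (generatorIso t).symm t.obj.property

end Closure

/-! ### Extending functors from the generators -/

section Universal

variable {k : Type u} [CommRing k] {S : Type u} [Category.{u} S]
  {Q : ObjectProperty (Sᵒᵖ ⥤ ModuleCat.{u} k)}
  {C : Type*} [Category.{u} C] [Preadditive C] [Linear k C]

variable (Q) in
/-- The functors `S ⥤ C` all of whose associated presheaves of morphisms are local. -/
def isColocalFunctor (H : S ⥤ C) : Prop :=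
  ∀ c : C, (invertedBy Q).isLocal (H.op ⋙ (linearYoneda k C).obj c)

/-- The functor sending `c` to the presheaf `s ↦ (H s ⟶ c)`. -/
def nerve {H : S ⥤ C} (hH : isColocalFunctor Q H) : C ⥤ LocalPresheaf Q :=
  (invertedBy Q).isLocal.lift (linearYoneda k C ⋙ (Functor.whiskeringLeft _ _ _).obj H.op) hH

/-- A morphism from the reflection of a free presheaf, as a morphism of `FinPresented Q`. -/
noncomputable def ofLocal {s : S} {t : FinPresented Q} (x : (localFree Q).obj s ⟶ t.obj) :
    (generator Q).obj s ⟶ t :=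
  ObjectProperty.homMk x

section Comparison

variable (G : FinPresented Q ⥤ C) [G.Additive] [G.Linear k]
  (hG : isColocalFunctor Q (generator Q ⋙ G))

/-- A morphism `f : G t ⟶ c` as a morphism from `t` to a nerve. -/
noncomputable def toNerve {t : FinPresented Q} {c : C} (f : G.obj t ⟶ c) :
    t.obj ⟶ (nerve hG).obj c :=
  ObjectProperty.homMk ((generatorIso t).inv ≫ Functor.whiskerLeft (generator Q).op
    (mapLinearYoneda G t ≫ Functor.whiskerLeft G.op ((linearYoneda k C).map f)))

theorem localFreeEquiv_comp_toNerve {s : S} {t : FinPresented Q} {c : C}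
    (x : (localFree Q).obj s ⟶ t.obj) (f : G.obj t ⟶ c) :
    localFreeEquiv (x ≫ toNerve G hG f) = G.map (ofLocal x) ≫ f := by
  rw [localFreeEquiv_comp]
  have : (generatorIso t).inv.app (Opposite.op s) (localFreeEquiv x) = ofLocal x :=
    congr($((generatorIso t).hom_inv_id_app (Opposite.op s)) (ofLocal x))
  change G.map ((generatorIso t).inv.app (Opposite.op s) (localFreeEquiv x)) ≫ f = _
  rw [this]

theorem toNerve_hom_ext {t : FinPresented Q} {c : C} {g : t.obj ⟶ (nerve hG).obj c}
    {f : G.obj t ⟶ c}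
    (h : ∀ (s : S) (x : (localFree Q).obj s ⟶ t.obj),
      G.map (ofLocal x) ≫ f = localFreeEquiv (x ≫ g)) :
    toNerve G hG f = g :=
  localPresheaf_hom_ext fun s x => (localFreeEquiv_comp_toNerve G hG x f).trans (h s x)

theorem comp_toNerve {t t' : FinPresented Q} {c : C} (a : t ⟶ t') (f : G.obj t' ⟶ c) :
    toNerve G hG (G.map a ≫ f) = a.hom ≫ toNerve G hG f :=
  toNerve_hom_ext G hG fun s x => by
    rw [← Category.assoc, ← G.map_comp, ← Category.assoc, localFreeEquiv_comp_toNerve]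
    rfl

variable [PreservesFiniteColimits G]

/-- On generators this is the Yoneda lemma. Both sides turn finite colimits in `t` into limits,
because `G` is right exact, so the property spreads to the whole closure. -/
theorem toNerve_bijective (t : FinPresented Q) (c : C) :
    Function.Bijective (toNerve G hG : (G.obj t ⟶ c) → _) := by
  let P : ObjectProperty (LocalPresheaf Q) := fun M =>
    ∃ h : finPresented Q M, ∀ c, Function.Bijective (toNerve G hG (t := ⟨M, h⟩) (c := c))
  have hP : P.IsClosedUnderIsomorphisms := by
    refine ⟨fun {M M'} e ⟨h, hM⟩ => ⟨(finPresented Q).prop_of_iso e h, fun c => ?_⟩⟩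
    let a : (⟨M, h⟩ : FinPresented Q) ≅ ⟨M', (finPresented Q).prop_of_iso e h⟩ :=
      (finPresented Q).isoMk e
    refine ⟨fun f f' hf => ?_, fun g => ?_⟩
    · rw [← cancel_epi (G.map a.hom)]
      refine (hM c).1 ?_
      rw [comp_toNerve, comp_toNerve, hf]
    · obtain ⟨f, hf⟩ := (hM c).2 (e.hom ≫ g)
      refine ⟨G.map a.inv ≫ f, ?_⟩
      rw [comp_toNerve, hf]
      exact e.inv_hom_id_assoc g
  suffices h : finPresented Q ≤ P from (h _ t.property).2 c
  refine finPresented_le (fun s => ⟨((generator Q).obj s).property, fun c => ?_⟩)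
    (fun J _ _ => ⟨fun X ⟨p⟩ => ?_⟩)
  · have h₁ (f : G.obj ((generator Q).obj s) ⟶ c) :
        localFreeEquiv (toNerve G hG f) = f := by
      have := localFreeEquiv_comp_toNerve G hG (t := (generator Q).obj s) (𝟙 _) f
      refine (congrArg localFreeEquiv (Category.id_comp (X := (localFree Q).obj s)
        (toNerve G hG f))).symm.trans (this.trans ?_)
      exact (congrArg (fun x => x ≫ f) (G.map_id ((generator Q).obj s))).trans (Category.id_comp f)
    exact ⟨Function.LeftInverse.injective h₁, fun g =>
      ⟨localFreeEquiv g, localFreeEquiv.injective (h₁ (localFreeEquiv g))⟩⟩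
  · let X' : FinPresented Q :=
      ⟨X, (finPresented Q).prop_of_isColimit p.isColimit fun j => (p.prop_diag_obj j).1⟩
    let D : J ⥤ FinPresented Q := (finPresented Q).lift p.diag fun j => (p.prop_diag_obj j).1
    let κ : Cocone D :=
      { pt := X'
        ι := { app := fun j => ObjectProperty.homMk (p.ι.app j)
               naturality := fun i j f => by ext1; exact p.ι.naturality f } }
    have hκ : IsColimit κ := isColimitOfReflects (finPresented Q).ι (p.isColimit)
    have hGκ := isColimitOfPreserves G hκ
    refine ⟨X'.property, fun c => ⟨fun f f' h => hGκ.hom_ext fun j => ?_, fun g => ?_⟩⟩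
    · refine ((p.prop_diag_obj j).2 c).1 ?_
      refine (comp_toNerve G hG (κ.ι.app j) f).trans (Eq.trans ?_
        (comp_toNerve G hG (κ.ι.app j) f').symm)
      rw [h]
    · choose f hf using fun j => ((p.prop_diag_obj j).2 c).2 (p.ι.app j ≫ g)
      have hf' {i j : J} (a : i ⟶ j) : G.map (D.map a) ≫ f j = f i := by
        refine ((p.prop_diag_obj i).2 c).1 ?_
        refine (comp_toNerve G hG (D.map a) (f j)).trans ?_
        rw [hf i]
        refine (congrArg (fun x => _ ≫ x) (hf j)).trans ?_
        exact p.w_assoc a g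
      refine ⟨hGκ.desc { pt := c, ι := { app := f, naturality := fun i j a => by simp [hf'] } }, ?_⟩
      refine p.isColimit.hom_ext fun j => ?_
      refine (comp_toNerve G hG (κ.ι.app j) _).symm.trans (Eq.trans ?_ (hf j))
      exact congrArg (toNerve G hG) (hGκ.fac _ j)

include hG in
theorem hom_ext_of_generator {t : FinPresented Q} {c : C} {f f' : G.obj t ⟶ c}
    (h : ∀ (s : S) (x : (generator Q).obj s ⟶ t), G.map x ≫ f = G.map x ≫ f') : f = f' :=
  (toNerve_bijective G hG t c).1 <| toNerve_hom_ext G hG fun s x =>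
    (h s (ofLocal x)).trans (localFreeEquiv_comp_toNerve G hG x f').symm

end Comparison

section Extension

variable {G G' : FinPresented Q ⥤ C} [G.Additive] [G.Linear k] [PreservesFiniteColimits G]
  (hG : isColocalFunctor Q (generator Q ⋙ G)) (hG' : isColocalFunctor Q (generator Q ⋙ G'))

include hG in
theorem nat_trans_ext_of_generator {α α' : G ⟶ G'}
    (h : Functor.whiskerLeft (generator Q) α = Functor.whiskerLeft (generator Q) α') : α = α' := by
  ext t
  refine hom_ext_of_generator G hG fun s x => ?_
  rw [α.naturality, α'.naturality]
  exact congr($(NatTrans.congr_app h s) ≫ G'.map x)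

include hG hG' in
theorem exists_nat_trans_of_generator [G'.Additive] [G'.Linear k] (β : generator Q ⋙ G ⟶ generator Q ⋙ G') :
    ∃ α : G ⟶ G', Functor.whiskerLeft (generator Q) α = β := by
  -- `β` induces a map of nerves in the opposite direction; the component at `t` corresponds to the
  -- image of the identity of `G' t` under it.
  let b (c : C) : (nerve hG').obj c ⟶ (nerve hG).obj c :=
    ObjectProperty.homMk (Functor.whiskerRight (NatTrans.op β) ((linearYoneda k C).obj c))
  choose f hf using fun t =>
    (toNerve_bijective G hG t (G'.obj t)).2 (toNerve G' hG' (𝟙 _) ≫ b (G'.obj t))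
  have hf' {s : S} {t : FinPresented Q} (x : (generator Q).obj s ⟶ t) :
      G.map x ≫ f t = β.app s ≫ G'.map x := by
    obtain ⟨x, rfl⟩ : ∃ y, x = ofLocal y := ⟨x.hom, rfl⟩
    rw [← localFreeEquiv_comp_toNerve G hG, hf, ← Category.assoc, localFreeEquiv_comp,
      localFreeEquiv_comp_toNerve, Category.comp_id]
    rfl
  refine ⟨{ app := f, naturality := fun t t' a => ?_ }, ?_⟩
  · refine hom_ext_of_generator G hG fun s x => ?_
    rw [← Category.assoc, ← G.map_comp, hf', ← Category.assoc, hf', Category.assoc, G'.map_comp]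
  · ext s
    have := hf' (𝟙 ((generator Q).obj s))
    rw [G.map_id, G'.map_id] at this
    exact (Category.id_comp _).symm.trans (this.trans (Category.comp_id _))

end Extension

section Existence

theorem lex_of_iso {X : Type*} [Category.{u} X] [Preadditive X] [Linear k X]
    {P P' : Xᵒᵖ ⥤ ModuleCat.{u} k} (e : P ≅ P') (hP : lex k X P) : lex k X P' := by
  obtain ⟨_, _, _⟩ := hP
  refine ⟨Functor.additive_of_iso e, Functor.linear_of_iso k e,
    preservesFiniteLimits_of_natIso e⟩

variable {H : S ⥤ C} (hH : isColocalFunctor Q H)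

/-- Morphisms from the reflection of a free presheaf to a nerve. -/
noncomputable def localFreeNerveEquiv {s : S} {c : C} :
    ((localFree Q).obj s ⟶ (nerve hH).obj c) ≃ (H.obj s ⟶ c) :=
  localFreeEquiv

theorem localFreeNerveEquiv_comp {s : S} {c c' : C} (φ : (localFree Q).obj s ⟶ (nerve hH).obj c)
    (g : c ⟶ c') :
    localFreeNerveEquiv hH (φ ≫ (nerve hH).map g) = localFreeNerveEquiv hH φ ≫ g :=
  localFreeEquiv_comp _ _

/-- On the reflected free presheaf at `s` the left adjoint takes the value `H s`, and its domain of
definition is closed under the finite colimits that `C` has. -/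
theorem finPresented_le_leftAdjointObjIsDefined [HasFiniteColimits C] :
    finPresented Q ≤ (nerve hH).leftAdjointObjIsDefined := by
  have : (nerve hH).leftAdjointObjIsDefined.IsClosedUnderIsomorphisms :=
    ⟨fun e h => by
      rw [Functor.leftAdjointObjIsDefined_iff] at h ⊢
      exact corepresentable_of_natIso _ (Functor.isoWhiskerLeft _ (coyoneda.mapIso e.op.symm))⟩
  refine finPresented_le (fun s => ?_) (fun J _ _ => ⟨fun X ⟨p⟩ => ?_⟩)
  · exact Functor.CorepresentableBy.isCorepresentable (X := H.obj s)
      { homEquiv := (localFreeNerveEquiv hH).symm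
        homEquiv_comp := fun g f => (localFreeNerveEquiv hH).injective (by
          refine Eq.trans ?_ (localFreeNerveEquiv_comp hH _ _).symm
          rw [Equiv.apply_symm_apply, Equiv.apply_symm_apply]) }
  · exact Functor.leftAdjointObjIsDefined_of_isColimit p.isColimit p.prop_diag_obj

instance : (nerve hH).Additive where
  map_add {c c' f g} := by
    ext s x
    exact Preadditive.comp_add _ _ _ x f g

instance : (nerve hH).Linear k where
  map_smul {c c'} f r := by
    ext s x
    exact Linear.comp_smul _ _ _ x r f

variable [HasFiniteColimits C]

/-- The right exact extension of a functor to `FinPresented Q`. -/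
noncomputable def extension : FinPresented Q ⥤ C :=
  ObjectProperty.ιOfLE (finPresented_le_leftAdjointObjIsDefined hH) ⋙
    (nerve hH).partialLeftAdjoint

/-- The universal property of the values of `extension`. -/
noncomputable def extensionEquiv {t : FinPresented Q} {c : C} :
    ((extension hH).obj t ⟶ c) ≃ (t.obj ⟶ (nerve hH).obj c) :=
  (nerve hH).partialLeftAdjointHomEquiv
    (X := (ObjectProperty.ιOfLE (finPresented_le_leftAdjointObjIsDefined hH)).obj t)

theorem extensionEquiv_comp {t : FinPresented Q} {c c' : C} (f : (extension hH).obj t ⟶ c)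
    (g : c ⟶ c') : extensionEquiv hH (f ≫ g) = extensionEquiv hH f ≫ (nerve hH).map g :=
  (nerve hH).partialLeftAdjointHomEquiv_comp f g

theorem extensionEquiv_map_comp {t t' : FinPresented Q} {c : C} (a : t ⟶ t')
    (f : (extension hH).obj t' ⟶ c) :
    extensionEquiv hH ((extension hH).map a ≫ f) = a.hom ≫ extensionEquiv hH f :=
  (nerve hH).partialLeftAdjointHomEquiv_map_comp
    ((ObjectProperty.ιOfLE (finPresented_le_leftAdjointObjIsDefined hH)).map a) f

theorem extensionEquiv_eq {t : FinPresented Q} {c : C} (f : (extension hH).obj t ⟶ c) :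
    extensionEquiv hH f = extensionEquiv hH (𝟙 _) ≫ (nerve hH).map f := by
  rw [← extensionEquiv_comp, Category.id_comp]

theorem extensionEquiv_add {t : FinPresented Q} {c : C} (f g : (extension hH).obj t ⟶ c) :
    extensionEquiv hH (f + g) = extensionEquiv hH f + extensionEquiv hH g := by
  rw [extensionEquiv_eq, Functor.map_add, Preadditive.comp_add, ← extensionEquiv_eq,
    ← extensionEquiv_eq]

theorem extensionEquiv_smul {t : FinPresented Q} {c : C} (r : k)
    (f : (extension hH).obj t ⟶ c) :
    extensionEquiv hH (r • f) = r • extensionEquiv hH f := by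
  rw [extensionEquiv_eq, Functor.map_smul, Linear.comp_smul, ← extensionEquiv_eq]

/-- Morphisms from `extension` to `c` are morphisms to the nerve of `c`, and the inclusion of
`FinPresented Q` is right exact; the criterion by representable presheaves applies. -/
theorem rex_extension : rex k _ _ (extension hH) := by
  refine rex_of_lex_op_comp_linearYoneda fun c => ?_
  refine lex_of_iso (NatIso.ofComponents (fun t => LinearEquiv.toModuleIso
    { (extensionEquiv hH (t := t.unop) (c := c)) with
      map_add' := extensionEquiv_add hH
      map_smul' := extensionEquiv_smul hH }) fun {t t'} a => ?_).symm
    (lex_op_comp_linearYoneda (rex_ι_finPresented (Q := Q)) ((nerve hH).obj c))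
  ext f
  exact extensionEquiv_map_comp hH a.unop f

/-- The value of `extension` on a generator. -/
noncomputable def generatorExtensionEquiv {s : S} {c : C} :
    ((extension hH).obj ((generator Q).obj s) ⟶ c) ≃ (H.obj s ⟶ c) :=
  (extensionEquiv hH).trans (localFreeNerveEquiv hH)

theorem generatorExtensionEquiv_comp {s : S} {c c' : C}
    (f : (extension hH).obj ((generator Q).obj s) ⟶ c) (g : c ⟶ c') :
    generatorExtensionEquiv hH (f ≫ g) = generatorExtensionEquiv hH f ≫ g :=
  (congrArg (localFreeNerveEquiv hH) (extensionEquiv_comp hH f g)).trans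
    (localFreeNerveEquiv_comp hH _ _)

theorem generatorExtensionEquiv_map_comp {s s' : S} {c : C} (a : s ⟶ s')
    (f : (extension hH).obj ((generator Q).obj s') ⟶ c) :
    generatorExtensionEquiv hH ((extension hH).map ((generator Q).map a) ≫ f) =
      H.map a ≫ generatorExtensionEquiv hH f :=
  (congrArg localFreeEquiv (extensionEquiv_map_comp hH ((generator Q).map a) f)).trans
    (localFreeEquiv_map_comp a _)

/-- `extension` extends the given functor. -/
noncomputable def generatorExtensionIso : H ≅ generator Q ⋙ extension hH :=
  NatIso.ofComponents (fun s =>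
    { hom := generatorExtensionEquiv hH (𝟙 _)
      inv := (generatorExtensionEquiv hH).symm (𝟙 _)
      hom_inv_id := by
        refine (generatorExtensionEquiv_comp hH _ _).symm.trans ?_
        rw [Category.id_comp, Equiv.apply_symm_apply]
      inv_hom_id := (generatorExtensionEquiv hH).injective (by
        rw [generatorExtensionEquiv_comp, Equiv.apply_symm_apply, Category.id_comp]
        rfl) })
    (fun {s s'} a => by
      refine (generatorExtensionEquiv_map_comp hH a (𝟙 _)).symm.trans ?_
      rw [Category.comp_id, ← Category.id_comp ((extension hH).map ((generator Q).map a))]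
      exact generatorExtensionEquiv_comp hH (𝟙 _) _)

end Existence

end Universal

/-! ### The tensor product as finitely cocomplete categories -/

section Product

variable {k : Type u} [CommRing k]

theorem rex_of_iso {X T : Type*} [Category* X] [Preadditive X] [Linear k X]
    [Category* T] [Preadditive T] [Linear k T] {K K' : X ⥤ T} (e : K ≅ K') (hK : rex k X T K) :
    rex k X T K' := by
  obtain ⟨_, _, _⟩ := hK
  exact ⟨Functor.additive_of_iso e, Functor.linear_of_iso k e,
    preservesFiniteColimits_of_natIso e⟩

variable (k)
  (A : Type u) [Category.{u} A] [Abelian A] [Linear k A]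
  (B : Type u) [Category.{u} B] [Abelian B] [Linear k B]

/-- The presheaves on `A × B` that are left exact and `k`-linear in each variable. -/
def bilex : ObjectProperty ((A × B)ᵒᵖ ⥤ ModuleCat.{u} k) := fun M =>
  (∀ a, lex k B ((Prod.sectR a B).op ⋙ M)) ∧ (∀ b, lex k A ((Prod.sectL A b).op ⋙ M))

variable {k A B}

theorem isLocal_invertedBy_bilex_iff (M : (A × B)ᵒᵖ ⥤ ModuleCat.{u} k) :
    (invertedBy (bilex k A B)).isLocal M ↔ bilex k A B M :=
  ⟨fun hM => ⟨fun a => lex_of_isLocal (fun _ hN => hN.1 a) hM,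
    fun b => lex_of_isLocal (fun _ hN => hN.2 b) hM⟩, le_isLocal_invertedBy _ M⟩

/-- The functor from `A × B` to its tensor product as finitely cocomplete categories, in curried
form. -/
noncomputable def tensorFunctor : A ⥤ B ⥤ FinPresented (bilex k A B) :=
  Functor.curry.obj (generator (bilex k A B))

theorem rex₂_tensorFunctor : rex₂ k A B _ (tensorFunctor (k := k) (A := A) (B := B)) :=
  ⟨fun a => rex_of_lex_op_comp_linearYoneda fun t =>
      ((isLocal_invertedBy_bilex_iff _).1 (isLocal_generator_comp_linearYoneda t)).1 a,
    fun b => rex_of_lex_op_comp_linearYoneda fun t =>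
      ((isLocal_invertedBy_bilex_iff _).1 (isLocal_generator_comp_linearYoneda t)).2 b⟩

variable {C : Type*} [Category.{u} C] [Preadditive C] [Linear k C]

theorem isColocalFunctor_of_rex {H : A × B ⥤ C} (h₁ : ∀ a, rex k B C (Prod.sectR a B ⋙ H))
    (h₂ : ∀ b, rex k A C (Prod.sectL A b ⋙ H)) : isColocalFunctor (bilex k A B) H := fun c =>
  (isLocal_invertedBy_bilex_iff _).2
    ⟨fun a => lex_op_comp_linearYoneda (h₁ a) c, fun b => lex_op_comp_linearYoneda (h₂ b) c⟩

theorem isColocalFunctor_generator_comp {G : FinPresented (bilex k A B) ⥤ C}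
    (hG : rex k _ C G) : isColocalFunctor (bilex k A B) (generator (bilex k A B) ⋙ G) :=
  isColocalFunctor_of_rex (fun a => (rex_comp (rex₂_tensorFunctor.1 a) hG :))
    (fun b => (rex_comp (rex₂_tensorFunctor.2 b) hG :))

theorem isColocalFunctor_uncurry {H : A ⥤ B ⥤ C} (hH : rex₂ k A B C H) :
    isColocalFunctor (bilex k A B) (Functor.uncurry.obj H) :=
  isColocalFunctor_of_rex
    (fun a => rex_of_iso (NatIso.ofComponents (fun b => Iso.refl ((H.obj a).obj b)) fun g => by
      change _ = 𝟙 _ ≫ (H.map (𝟙 a)).app _ ≫ (H.obj a).map g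
      simp; exact Category.comp_id _) (hH.1 a))
    (fun b => rex_of_iso (NatIso.ofComponents (fun a => Iso.refl ((H.obj a).obj b)) fun f => by
      change _ = 𝟙 _ ≫ (H.map f).app b ≫ (H.obj _).map (𝟙 b)
      simp; exact Category.comp_id _) (hH.2 b))

theorem faithful_compWith_tensorFunctor :
    (compWith (rex₂_tensorFunctor (k := k) (A := A) (B := B)) C).Faithful where
  map_injective {G G'} α α' h := by
    obtain ⟨_, _, _⟩ := G.property
    ext1
    refine nat_trans_ext_of_generator (isColocalFunctor_generator_comp G.property) ?_
    ext x
    exact congr(($(h).hom.app x.1).app x.2)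

theorem full_compWith_tensorFunctor :
    (compWith (rex₂_tensorFunctor (k := k) (A := A) (B := B)) C).Full where
  map_surjective {G G'} γ := by
    obtain ⟨_, _, _⟩ := G.property
    obtain ⟨_, _, _⟩ := G'.property
    let β : generator (bilex k A B) ⋙ G.obj ⟶ generator (bilex k A B) ⋙ G'.obj :=
      { app := fun x => (γ.hom.app x.1).app x.2
        naturality := fun x y f => by
          -- Naturality is known in each variable separately, so the morphism is split into its two
          -- components.
          have h : f = ((f.1, 𝟙 x.2) : x ⟶ (y.1, x.2)) ≫ ((𝟙 y.1, f.2) : (y.1, x.2) ⟶ y) := by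
            ext <;> simp
          have h₁ := NatTrans.congr_app (γ.hom.naturality f.1) x.2
          have h₂ := (γ.hom.app y.1).naturality f.2
          rw [h, Functor.map_comp, Functor.map_comp]
          refine (Category.assoc _ _ _).trans ?_
          refine (congrArg (fun g => _ ≫ g) h₂).trans ?_
          refine (Category.assoc _ _ _).symm.trans ((congrArg (fun g => g ≫ _) h₁).trans ?_)
          exact Category.assoc _ _ _ }
    obtain ⟨α, hα⟩ := exists_nat_trans_of_generator (isColocalFunctor_generator_comp G.property)
      (isColocalFunctor_generator_comp G'.property) β
    refine ⟨ObjectProperty.homMk α, ?_⟩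
    ext a b
    exact NatTrans.congr_app hα (a, b)

theorem essSurj_compWith_tensorFunctor [HasFiniteColimits C] :
    (compWith (rex₂_tensorFunctor (k := k) (A := A) (B := B)) C).EssSurj where
  mem_essImage H := by
    have hH := isColocalFunctor_uncurry H.property
    let e := (generatorExtensionIso hH).symm
    refine ⟨⟨extension hH, rex_extension hH⟩, ⟨(rex₂ k A B C).isoMk ?_⟩⟩
    refine NatIso.ofComponents
      (fun a => NatIso.ofComponents (fun b => e.app (a, b)) fun {b b'} g => ?_) fun {a a'} f => ?_
    · exact (e.hom.naturality ((𝟙 a, g) : (a, b) ⟶ (a, b'))).trans (by simp; rfl)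
    · ext b
      exact (e.hom.naturality ((f, 𝟙 b) : (a, b) ⟶ (a', b))).trans (by simp; rfl)

theorem isFinCocompleteTensor_tensorFunctor :
    IsFinCocompleteTensor k (tensorFunctor (k := k) (A := A) (B := B)) where
  hasFiniteColimits := inferInstance
  rex₂ := rex₂_tensorFunctor
  universal _ := { faithful := faithful_compWith_tensorFunctor
                   full := full_compWith_tensorFunctor
                   essSurj := essSurj_compWith_tensorFunctor }

end Product

theorem exists_isFinCocompleteTensor (k : Type u) [CommRing k]
    (A : Type u) [Category.{u} A] [Abelian A] [Linear k A]
    (B : Type u) [Category.{u} B] [Abelian B] [Linear k B] :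
    ∃ (T : Type (u + 1)) (_ : Category.{u} T) (_ : Preadditive T) (_ : Linear k T)
      (τ : A ⥤ B ⥤ T), EssentiallySmall.{u} T ∧ IsFinCocompleteTensor k τ :=
  ⟨FinPresented (bilex k A B), inferInstance, inferInstance, inferInstance, tensorFunctor,
    inferInstance, isFinCocompleteTensor_tensorFunctor⟩

/-! ### A Deligne tensor product makes `T` abelian -/

section Abelian

variable {k : Type u} [CommRing k]
  {D : Type*} [Category.{u} D] [Abelian D] [Linear k D]
  {T : Type*} [Category.{u} T] [Preadditive T] [Linear k T]
  {F : T ⥤ D}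

theorem isAbelianCategory_of_precomp_isEquivalence [HasFiniteColimits T] [EssentiallySmall.{u} T]
    (hF : rex k T D F) (h : (precomp hF (ModuleCat.{u} k)ᵒᵖ).IsEquivalence) :
    IsAbelianCategory T := by
  have : F.IsEquivalence :=
    { faithful := faithful_of_precomp_isEquivalence hF h
      full := full_of_precomp_isEquivalence hF h
      essSurj := essSurj_of_precomp_isEquivalence hF h }
  have : HasFiniteProducts T :=
    ⟨fun _ => Adjunction.hasLimitsOfShape_of_equivalence F⟩
  exact ⟨abelianOfEquivalence F, rfl⟩

end Abelian

section Comparison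

variable {k : Type u} [CommRing k]
  {A : Type u} [Category.{u} A] [Preadditive A] [Linear k A]
  {B : Type u} [Category.{u} B] [Preadditive B] [Linear k B]
  {T : Type (u + 1)} [Category.{u} T] [Preadditive T] [Linear k T] {τ : A ⥤ B ⥤ T}

theorem IsFinCocompleteTensor.essentiallySmall (hτ : IsFinCocompleteTensor k τ)
    {T' : Type (u + 1)} [Category.{u} T'] [Preadditive T'] [Linear k T'] {τ' : A ⥤ B ⥤ T'}
    (hτ' : IsFinCocompleteTensor k τ') [EssentiallySmall.{u} T'] : EssentiallySmall.{u} T := by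
  have := hτ.hasFiniteColimits
  have := hτ'.hasFiniteColimits
  obtain ⟨e, -⟩ := exists_equivalence_of_universal hτ.rex₂ hτ'.rex₂ (hτ.universal T)
    (hτ.universal T') (hτ'.universal T) (hτ'.universal T')
  exact (essentiallySmall_congr e).2 inferInstance

theorem IsFinCocompleteTensor.isAbelianCategory (hτ : IsFinCocompleteTensor k τ)
    [EssentiallySmall.{u} T]
    {D : Type (u + 1)} [Category.{u} D] [Preadditive D] [Linear k D] {χ : A ⥤ B ⥤ D}
    (hχ : IsDeligneTensor k χ) : IsAbelianCategory T := by
  obtain ⟨_, rfl⟩ := id hχ.isAbelian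
  have := hτ.hasFiniteColimits
  obtain ⟨F, hF, ⟨i⟩⟩ := exists_factorization hτ.rex₂ (hτ.universal D) hχ.rex₂
  exact isAbelianCategory_of_precomp_isEquivalence hF
    (precomp_isEquivalence hτ.rex₂ hχ.rex₂ hF i (hτ.universal _) (hχ.universal _))

theorem IsFinCocompleteTensor.isDeligneTensor (hτ : IsFinCocompleteTensor k τ)
    (hT : IsAbelianCategory T) : IsDeligneTensor k τ where
  isAbelian := hT
  rex₂ := hτ.rex₂
  universal C := hτ.universal C

theorem IsDeligneTensor.exists_equivalence (hτ : IsDeligneTensor k τ)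
    {D : Type (u + 1)} [Category.{u} D] [Preadditive D] [Linear k D] {χ : A ⥤ B ⥤ D}
    (hχ : IsDeligneTensor k χ) :
    ∃ e : T ≌ D, e.functor.Additive ∧ e.functor.Linear k ∧
      Nonempty (((Functor.postcompose₂).obj e.functor).obj τ ≅ χ) := by
  obtain ⟨_, rfl⟩ := id hτ.isAbelian
  obtain ⟨_, rfl⟩ := id hχ.isAbelian
  exact exists_equivalence_of_universal hτ.rex₂ hχ.rex₂ (hτ.universal T) (hτ.universal D)
    (hχ.universal T) (hχ.universal D)

end Comparison

end DeligneTensor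

/-- `A` and `B` are small abelian `k`-linear categories. The tensor product `A ⊠ B` as finitely
cocomplete categories exists (and is essentially small). For each model `(T, τ)` of it, Deligne's
tensor product exists if and only if `T` is abelian; if `T` is abelian then `(T, τ)` is a Deligne
tensor product, and each Deligne tensor product `(D, χ)` is equivalent to `(T, τ)`. -/
theorem mainTheorem1 (k : Type u) [CommRing k]
    (A : Type u) [Category.{u} A] [Abelian A] [Linear k A]
    (B : Type u) [Category.{u} B] [Abelian B] [Linear k B] :
    (∃ (T : Type (u + 1)) (_ : Category.{u} T) (_ : Preadditive T) (_ : Linear k T)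
      (τ : A ⥤ B ⥤ T), EssentiallySmall.{u} T ∧ DeligneTensor.IsFinCocompleteTensor k τ) ∧
    ∀ (T : Type (u + 1)) [Category.{u} T] [Preadditive T] [Linear k T] (τ : A ⥤ B ⥤ T),
      DeligneTensor.IsFinCocompleteTensor k τ →
        (DeligneTensor.DeligneTensorExists k A B ↔ DeligneTensor.IsAbelianCategory T) ∧
        (DeligneTensor.IsAbelianCategory T → DeligneTensor.IsDeligneTensor k τ) ∧
        (∀ (D : Type (u + 1)) [Category.{u} D] [Preadditive D] [Linear k D] (χ : A ⥤ B ⥤ D),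
          DeligneTensor.IsDeligneTensor k χ →
            ∃ e : T ≌ D, e.functor.Additive ∧ e.functor.Linear k ∧
              Nonempty (((Functor.postcompose₂).obj e.functor).obj τ ≅ χ)) := by
  refine ⟨DeligneTensor.exists_isFinCocompleteTensor k A B, fun T _ _ _ τ hτ => ?_⟩
  -- The given `T` is equivalent to the constructed model, hence essentially small; the filtered
  -- colimits behind essential surjectivity need this.
  obtain ⟨T', _, _, _, τ', _, hτ'⟩ := DeligneTensor.exists_isFinCocompleteTensor k A B
  have := hτ.essentiallySmall hτ'
  refine ⟨⟨fun ⟨D, _, _, _, χ, hχ⟩ => hτ.isAbelianCategory hχ,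
    fun hT => ⟨T, _, _, _, τ, hτ.isDeligneTensor hT⟩⟩, hτ.isDeligneTensor, fun D _ _ _ χ hχ => ?_⟩
  exact (hτ.isDeligneTensor (hτ.isAbelianCategory hχ)).exists_equivalence hχ
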